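/- Let $A$ and $B$ be finite-dimensional complex Hilbert spaces with fixed orthonormal bases and $A\neq\{0\}$. Let $\Phi:\mathbb L(A)\to\mathbb L(B)$ be a linear map between the spaces of linear operators on $A$ and $B$ which is Hermiticity-preserving, i.e. $\Phi(X)$ is Hermitian whenever $X$ is Hermitian. Let $J_\Phi=(\mathrm{id}_A\otimes\Phi)(|\Omega\rangle\langle\Omega|)$, with $|\Omega\rangle=\sum_i|ii\rangle$, be its Choi operator on $A\otimes B$, and let its diamond norm be $$\|\Phi\|_\diamond=\max\{\|(\mathrm{id}_A\otimes\Phi)(\rho)\|_1 : \rho \text{ a density operator on } A\otimes A\},$$ where $\|X\|_1=\operatorname{Tr}\sqrt{X^\dagger X}$ and a density operator is a positive semidefinite operator of unit trace. Then this maximum is attained, and $$\|\Phi\|_\diamond=\min\{\mu\in\mathbb R : J_\Phi=M_+-M_-,\ M_\pm\ge 0,\ \operatorname{Tr}_B(M_++M_-)\le\mu\mathbb 1_A\}$$ $$\phantom{\|\Phi\|_\diamond}=\min\{\mu\in\mathbb R : J_\Phi=M_+-M_-,\ M_\pm\ge 0,\ \operatorname{Tr}_B(M_++M_-)=\mu\mathbb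 1_A\},$$ where $M_\pm$ range over the operators on $A\otimes B$, $\ge$ is the positive semidefinite order, $\operatorname{Tr}_B$ is the partial trace over $B$, and both minima are attained. -/

import Mathlib

open scoped Kronecker ComplexOrder

namespace QMap

/-- `Φ` maps Hermitian operators to Hermitian operators. -/
def HermiticityPreserving {A B : Type*} (Φ : Matrix A A ℂ →ₗ[ℂ] Matrix B B ℂ) : Prop :=
  ∀ X : Matrix A A ℂ, X.IsHermitian → (Φ X).IsHermitian

/-- The density operators: positive semidefinite with unit trace. -/
def IsDensity {n : Type*} [Fintype n] (ρ : Matrix n n ℂ) : Prop :=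
  ρ.PosSemidef ∧ ρ.trace = 1

/-- The map `id_R ⊗ Φ`: apply `Φ` to each block of an operator on `R ⊗ A`. -/
def idTensor (R : Type*) {A B : Type*} (Φ : Matrix A A ℂ →ₗ[ℂ] Matrix B B ℂ) :
    Matrix (R × A) (R × A) ℂ →ₗ[ℂ] Matrix (R × B) (R × B) ℂ where
  toFun X := Matrix.of fun p q => Φ (Matrix.of fun i j => X (p.1, i) (q.1, j)) p.2 q.2
  map_add' X Y := by
    ext p q
    exact congrFun (congrFun (map_add Φ (Matrix.of fun i j => X (p.1, i) (q.1, j))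
      (Matrix.of fun i j => Y (p.1, i) (q.1, j))) p.2) q.2
  map_smul' c X := by
    ext p q
    exact congrFun (congrFun (map_smul Φ c (Matrix.of fun i j => X (p.1, i) (q.1, j))) p.2) q.2

/-- `(id ⊗ Φ) (X ⊗ Y) = X ⊗ Φ Y`, which characterises `id ⊗ Φ`. -/
theorem idTensor_kronecker {R A B : Type*} (Φ : Matrix A A ℂ →ₗ[ℂ] Matrix B B ℂ)
    (X : Matrix R R ℂ) (Y : Matrix A A ℂ) : idTensor R Φ (X ⊗ₖ Y) = X ⊗ₖ Φ Y := by
  ext p q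
  exact congrFun (congrFun (map_smul Φ (X p.1 q.1) Y) p.2) q.2

/-- The unnormalised maximally entangled vector `∑ i, |i i⟩`. -/
def maxEntVec (A : Type*) [DecidableEq A] : A × A → ℂ :=
  fun p => if p.1 = p.2 then 1 else 0

/-- The Choi operator `J_Φ = (id_A ⊗ Φ) (|Ω⟩⟨Ω|)` on `A ⊗ B`. -/
def choi {A B : Type*} [DecidableEq A] (Φ : Matrix A A ℂ →ₗ[ℂ] Matrix B B ℂ) :
    Matrix (A × B) (A × B) ℂ :=
  idTensor A Φ (Matrix.vecMulVec (maxEntVec A) (star (maxEntVec A)))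

/-- The partial trace `Tr_B` of an operator on `A ⊗ B`. -/
def partialTraceB {A B : Type*} [Fintype B] (M : Matrix (A × B) (A × B) ℂ) : Matrix A A ℂ :=
  Matrix.of fun i j => ∑ b, M (i, b) (j, b)

/-- The trace norm (Schatten 1-norm) `‖X‖₁ = Tr √(X† X)`: the sum of the singular values of `X`,
which are the square roots of the eigenvalues of `X† X`. -/
noncomputable def traceNorm {n : Type*} [Fintype n] [DecidableEq n] (X : Matrix n n ℂ) : ℝ :=
  ∑ i, √((Matrix.isHermitian_conjTranspose_mul_self X).eigenvalues i)

/-- The values `‖(id_A ⊗ Φ) ρ‖₁` over all states `ρ` on `A ⊗ A`. -/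
def diamondValues {A B : Type*} [Fintype A] [DecidableEq A] [Fintype B] [DecidableEq B]
    (Φ : Matrix A A ℂ →ₗ[ℂ] Matrix B B ℂ) : Set ℝ :=
  {x | ∃ ρ : Matrix (A × A) (A × A) ℂ, IsDensity ρ ∧ x = traceNorm (idTensor A Φ ρ)}

/-- The diamond norm of `Φ`. -/
noncomputable def diamondNorm {A B : Type*} [Fintype A] [DecidableEq A] [Fintype B]
    [DecidableEq B] (Φ : Matrix A A ℂ →ₗ[ℂ] Matrix B B ℂ) : ℝ :=
  sSup (diamondValues Φ)

end QMap

/-! Semidefinite duality through the Choi operator `J`. Weak duality: `link` preserves positivity,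
so if `J = P - Q` with `P, Q ≥ 0`, the output on a state `ρ` has trace norm at most the trace of
`link (P + Q) ρ`. This is the pairing of `Tr_B (P + Q)` with the transposed marginal of `ρ`, hence
at most `μ` (`traceNorm_link_sub_le`).

Strong duality: let `D` bound all output trace norms. If `(J, D • 1)` were outside the closed convex
cone `decompositionCone`, Hahn–Banach would give `Y` and `σ ≥ 0` with `-σ ⊗ 1 ≤ Y ≤ σ ⊗ 1` and `Tr
(Y J) > D Tr σ`. But for invertible `σ = Kᴴ K`, the normalised vector with coefficient matrix `K` is
a pure state, and conjugating `Y` by `(K ⊗ 1)⁻¹` gives `-1 ≤ W ≤ 1` witnessing `Tr (Y J) ≤ D Tr σ`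
(`re_trace_mul_le_of_posDef`). Closedness of the cone makes the minimum attained; spreading the
slack over `B` turns the inequality into an equality. -/

open Matrix

/-! ### Trace pairing and compactness for positive semidefinite matrices. -/

namespace Matrix

variable {n m : Type*} [Fintype n] [Fintype m]

open scoped MatrixOrder in
theorem PosSemidef.exists_eq_conjTranspose_mul_self {P : Matrix n n ℂ} (hP : P.PosSemidef) :
    ∃ C : Matrix n n ℂ, P = Cᴴ * C := by
  classical
  exact CStarAlgebra.nonneg_iff_eq_star_mul_self.mp hP.nonneg

theorem PosSemidef.trace_mul_nonneg {P Q : Matrix n n ℂ} (hP : P.PosSemidef)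
    (hQ : Q.PosSemidef) : 0 ≤ (P * Q).trace := by
  obtain ⟨C, rfl⟩ := hP.exists_eq_conjTranspose_mul_self
  rw [Matrix.mul_assoc, trace_mul_comm]
  exact (hQ.mul_mul_conjTranspose_same C).trace_nonneg

theorem PosSemidef.re_trace_mul_nonneg {P Q : Matrix n n ℂ} (hP : P.PosSemidef)
    (hQ : Q.PosSemidef) : 0 ≤ (P * Q).trace.re :=
  (Complex.le_def.mp (hP.trace_mul_nonneg hQ)).1

theorem PosSemidef.re_trace_nonneg {P : Matrix n n ℂ} (hP : P.PosSemidef) : 0 ≤ P.trace.re :=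
  (Complex.le_def.mp hP.trace_nonneg).1

theorem PosSemidef.ofReal_re_trace {P : Matrix n n ℂ} (hP : P.PosSemidef) :
    ((P.trace.re : ℝ) : ℂ) = P.trace :=
  Complex.ext rfl (by simpa using (Complex.le_def.mp hP.trace_nonneg).2)

/-- Self-duality of the positive semidefinite cone; rank-one tests suffice. -/
theorem IsHermitian.posSemidef_of_re_trace_mul {H : Matrix n n ℂ} (hH : H.IsHermitian)
    (h : ∀ M : Matrix n n ℂ, M.PosSemidef → 0 ≤ (H * M).trace.re) : H.PosSemidef := by
  refine .of_dotProduct_mulVec_nonneg hH fun x => ?_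
  have key : (H * vecMulVec x (star x)).trace = star x ⬝ᵥ (H *ᵥ x) := by
    rw [mul_vecMulVec, trace_vecMulVec, dotProduct_comm]
  have h1 := h _ (posSemidef_vecMulVec_self_star x)
  rw [key] at h1
  exact Complex.le_def.mpr ⟨h1, (hH.im_star_dotProduct_mulVec_self x).symm⟩

theorem IsHermitian.re_trace_conjTranspose_mul {H : Matrix n n ℂ} (hH : H.IsHermitian)
    (Z : Matrix n n ℂ) : (Zᴴ * H).trace.re = (Z * H).trace.re := by
  have : (Zᴴ * H) = (H * Z)ᴴ := by rw [conjTranspose_mul, hH.eq]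
  rw [this, trace_conjTranspose, trace_mul_comm]
  simp

/-- The Hermitian part of a matrix. -/
noncomputable def hermitianPart {k : Type*} (Z : Matrix k k ℂ) : Matrix k k ℂ := (2⁻¹ : ℂ) • (Z + Zᴴ)

theorem isHermitian_hermitianPart {k : Type*} (Z : Matrix k k ℂ) : (hermitianPart Z).IsHermitian := by
  simp [hermitianPart, IsHermitian, add_comm]

theorem IsHermitian.re_trace_hermitianPart_mul {H : Matrix n n ℂ} (hH : H.IsHermitian)
    (Z : Matrix n n ℂ) : (hermitianPart Z * H).trace.re = (Z * H).trace.re := by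
  have := hH.re_trace_conjTranspose_mul Z
  have h2 : (hermitianPart Z * H).trace = (2⁻¹ : ℝ) • ((Z * H).trace + (Zᴴ * H).trace) := by
    simp [hermitianPart, add_mul]
  rw [h2, Complex.smul_re, Complex.add_re, this, smul_eq_mul]
  ring

theorem PosSemidef.norm_apply_le {P : Matrix n n ℂ} (hP : P.PosSemidef) (i j : n) :
    ‖P i j‖ ≤ P.trace.re := by
  obtain ⟨C, rfl⟩ := hP.exists_eq_conjTranspose_mul_self
  have hd : ∀ i, ((Cᴴ * C) i i).re = ∑ k, ‖C k i‖ ^ 2 := fun i => by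
    simp only [mul_apply, conjTranspose_apply, Complex.re_sum]
    refine Finset.sum_congr rfl fun k _ => ?_
    rw [RCLike.star_def, ← Complex.normSq_eq_conj_mul_self, Complex.ofReal_re,
      Complex.normSq_eq_norm_sq]
  have hle : ∀ i, ((Cᴴ * C) i i).re ≤ (Cᴴ * C).trace.re := fun i => by
    rw [trace, Complex.re_sum]
    exact Finset.single_le_sum (f := fun i => ((Cᴴ * C) i i).re)
      (fun i _ => by rw [hd]; positivity) (Finset.mem_univ i)
  have h1 : ‖(Cᴴ * C) i j‖ ≤ (((Cᴴ * C) i i).re + ((Cᴴ * C) j j).re) / 2 := by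
    rw [hd, hd, ← Finset.sum_add_distrib, Finset.sum_div, mul_apply]
    refine (norm_sum_le _ _).trans (Finset.sum_le_sum fun k _ => ?_)
    rw [norm_mul, conjTranspose_apply, norm_star]
    nlinarith [sq_nonneg (‖C k i‖ - ‖C k j‖)]
  linarith [hle i, hle j]

theorem isClosed_setOf_posSemidef : IsClosed {P : Matrix n n ℂ | P.PosSemidef} := by
  simp only [posSemidef_iff_dotProduct_mulVec, Set.ofPred_and, Set.ofPred_forall]
  refine IsClosed.inter (isClosed_eq (by fun_prop) continuous_id)
    (isClosed_iInter fun x => isClosed_le continuous_const (by fun_prop))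

theorem isCompact_posSemidef_trace_le (R : ℝ) :
    IsCompact {P : Matrix n n ℂ | P.PosSemidef ∧ P.trace.re ≤ R} := by
  have hK : IsCompact (Set.univ.pi fun _ : n => Set.univ.pi fun _ : n =>
      Metric.closedBall (0 : ℂ) R) :=
    isCompact_univ_pi fun _ => isCompact_univ_pi fun _ => isCompact_closedBall _ _
  refine IsCompact.of_isClosed_subset (X := Matrix n n ℂ) hK ?_ ?_
  · exact isClosed_setOf_posSemidef.inter (isClosed_le
      (Complex.continuous_re.comp (continuous_id.matrix_trace)) continuous_const)
  · intro P hP i _ j _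
    simpa using (hP.1.norm_apply_le i j).trans hP.2

end Matrix

/-! ### Variational description of the trace norm. -/

namespace QMap

variable {n : Type*} [Fintype n] [DecidableEq n]

theorem traceNorm_eq_sum_abs {X : Matrix n n ℂ} (hX : X.IsHermitian) :
    traceNorm X = ∑ i, |hX.eigenvalues i| := by
  have hs := hX.spectral_theorem
  -- The two eigenvalue families are indexed independently, so they are compared as multisets of
  -- roots.
  have h2 : (Xᴴ * X).charpoly.roots =
      Multiset.map (fun i => ((hX.eigenvalues i ^ 2 : ℝ) : ℂ)) Finset.univ.val := by
    have : Xᴴ * X = (hX.eigenvectorUnitary : Matrix n n ℂ) *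
        diagonal (fun i => ((hX.eigenvalues i ^ 2 : ℝ) : ℂ)) *
        star (hX.eigenvectorUnitary : Matrix n n ℂ) := by
      rw [hX.eq]
      conv_lhs => rw [hs]
      rw [← map_mul, diagonal_mul_diagonal, Unitary.conjStarAlgAut_apply]
      simp [sq]
    rw [this, charpoly_mul_comm, ← mul_assoc]
    simp only [Unitary.coe_star_mul_self, one_mul, charpoly_diagonal]
    have h := Polynomial.roots_multiset_prod_X_sub_C
      (Multiset.map (fun i => ((hX.eigenvalues i ^ 2 : ℝ) : ℂ)) Finset.univ.val)
    rwa [Multiset.map_map] at h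
  rw [(isHermitian_conjTranspose_mul_self X).roots_charpoly_eq_eigenvalues] at h2
  have h3 := congrArg (fun s => (Multiset.map (fun z : ℂ => √z.re) s).sum) h2
  simp only [Multiset.map_map, Function.comp_def, Complex.ofReal_re, Real.sqrt_sq_eq_abs] at h3
  exact h3

/-- In an eigenbasis of `X` the diagonal entries of `W` have real part in `[-1, 1]`. -/
theorem re_trace_mul_le_traceNorm {X W : Matrix n n ℂ} (hX : X.IsHermitian)
    (h₁ : (1 - W).PosSemidef) (h₂ : (1 + W).PosSemidef) : (W * X).trace.re ≤ traceNorm X := by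
  rw [traceNorm_eq_sum_abs hX]
  set U := hX.eigenvectorUnitary
  have hU : star (U : Matrix n n ℂ) * (U : Matrix n n ℂ) = 1 := Unitary.coe_star_mul_self U
  have key : (W * X).trace =
      ∑ i, (star (U : Matrix n n ℂ) * W * (U : Matrix n n ℂ)) i i * (hX.eigenvalues i : ℂ) := by
    conv_lhs => rw [hX.spectral_theorem]
    rw [Unitary.conjStarAlgAut_apply, ← mul_assoc, trace_mul_comm, ← mul_assoc, ← mul_assoc]
    simp [trace, mul_diagonal, U]
  rw [key, Complex.re_sum]
  refine Finset.sum_le_sum fun i _ => ?_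
  have e1 := (Complex.le_def.mp ((h₁.conjTranspose_mul_mul_same
    (U : Matrix n n ℂ)).diag_nonneg (i := i))).1
  have e2 := (Complex.le_def.mp ((h₂.conjTranspose_mul_mul_same
    (U : Matrix n n ℂ)).diag_nonneg (i := i))).1
  rw [← star_eq_conjTranspose, mul_sub, sub_mul, mul_one, hU] at e1
  rw [← star_eq_conjTranspose, mul_add, add_mul, mul_one, hU] at e2
  simp only [Matrix.sub_apply, Matrix.add_apply, one_apply_eq, Complex.sub_re, Complex.add_re, Complex.one_re,
    Complex.zero_re] at e1 e2
  rw [Complex.re_mul_ofReal]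
  refine (le_abs_self _).trans ?_
  rw [abs_mul]
  exact mul_le_of_le_one_left (abs_nonneg _) (abs_le.mpr ⟨by linarith, by linarith⟩)

theorem exists_re_trace_mul_eq_traceNorm {X : Matrix n n ℂ} (hX : X.IsHermitian) :
    ∃ W : Matrix n n ℂ, (1 - W).PosSemidef ∧ (1 + W).PosSemidef ∧
      (W * X).trace.re = traceNorm X := by
  set U := hX.eigenvectorUnitary
  -- The optimal `W` is the sign of `X`.
  set s : n → ℝ := fun i => if 0 ≤ hX.eigenvalues i then 1 else -1
  have h1 : (1 : Matrix n n ℂ) = Unitary.conjStarAlgAut ℂ _ U (diagonal fun _ => 1) := by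
    rw [diagonal_one, map_one]
  refine ⟨Unitary.conjStarAlgAut ℂ _ U (diagonal fun i => (s i : ℂ)), ?_, ?_, ?_⟩
  · rw [h1, ← map_sub, diagonal_sub, Unitary.conjStarAlgAut_apply]
    refine PosSemidef.mul_mul_conjTranspose_same (posSemidef_diagonal_iff.mpr fun i => ?_) _
    simp only [s]; split_ifs <;> norm_num
  · rw [h1, ← map_add, diagonal_add, Unitary.conjStarAlgAut_apply]
    refine PosSemidef.mul_mul_conjTranspose_same (posSemidef_diagonal_iff.mpr fun i => ?_) _
    simp only [s]; split_ifs <;> norm_num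
  · rw [traceNorm_eq_sum_abs hX]
    conv_lhs => rw [hX.spectral_theorem]
    rw [← map_mul, diagonal_mul_diagonal, Unitary.conjStarAlgAut_apply, trace_mul_comm, ← mul_assoc]
    simp only [U, Unitary.coe_star_mul_self, one_mul, trace_diagonal, Complex.re_sum]
    refine Finset.sum_congr rfl fun i _ => ?_
    simp only [s]
    split_ifs with h
    · simp [abs_of_nonneg h]
    · simp [abs_of_neg (not_le.mp h)]

theorem traceNorm_sub_le {P Q : Matrix n n ℂ} (hP : P.PosSemidef) (hQ : Q.PosSemidef) :
    traceNorm (P - Q) ≤ (P + Q).trace.re := by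
  obtain ⟨W, h₁, h₂, h⟩ := exists_re_trace_mul_eq_traceNorm (hP.1.sub hQ.1)
  rw [← h]
  have e1 := h₁.re_trace_mul_nonneg hP
  have e2 := h₂.re_trace_mul_nonneg hQ
  simp only [sub_mul, add_mul, mul_sub, one_mul, trace_sub, trace_add, Complex.sub_re,
    Complex.add_re] at e1 e2 ⊢
  linarith

end QMap

/-! ### Choi operators, their action on states, and weak duality. -/

namespace QMap

variable {R A B : Type*}

/-- The action on `ρ` of `id_R ⊗ Φ`, where `Φ` is the map with Choi operator `M`. -/
def link [Fintype A] (M : Matrix (A × B) (A × B) ℂ) (ρ : Matrix (R × A) (R × A) ℂ) :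
    Matrix (R × B) (R × B) ℂ :=
  Matrix.of fun p q => ∑ i, ∑ j, ρ (p.1, i) (q.1, j) * M (i, p.2) (j, q.2)

theorem choi_apply [DecidableEq A] (Φ : Matrix A A ℂ →ₗ[ℂ] Matrix B B ℂ) (p q : A × B) :
    choi Φ p q = Φ (single p.1 q.1 1) p.2 q.2 := by
  simp only [choi, idTensor, LinearMap.coe_mk, AddHom.coe_mk, of_apply]
  refine congrFun (congrFun (congrArg Φ ?_) p.2) q.2
  ext k l
  simp [vecMulVec_apply, maxEntVec, single_apply, and_comm, ← ite_and]

theorem idTensor_eq_link [Fintype A] [DecidableEq A] (Φ : Matrix A A ℂ →ₗ[ℂ] Matrix B B ℂ)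
    (ρ : Matrix (R × A) (R × A) ℂ) : idTensor R Φ ρ = link (choi Φ) ρ := by
  ext p q
  simp only [link, of_apply, choi_apply, idTensor, LinearMap.coe_mk, AddHom.coe_mk]
  conv_lhs => rw [matrix_eq_sum_single (of fun i j => ρ (p.1, i) (q.1, j))]
  simp only [map_sum, Matrix.sum_apply, of_apply]
  refine Finset.sum_congr rfl fun i _ => Finset.sum_congr rfl fun j _ => ?_
  rw [← mul_one (ρ _ _), ← smul_eq_mul, ← smul_single, map_smul]
  simp

theorem link_sub [Fintype A] (M N : Matrix (A × B) (A × B) ℂ) (ρ : Matrix (R × A) (R × A) ℂ) :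
    link (M - N) ρ = link M ρ - link N ρ := by
  ext p q
  simp [link, mul_sub, Finset.sum_sub_distrib]

theorem link_add [Fintype A] (M N : Matrix (A × B) (A × B) ℂ) (ρ : Matrix (R × A) (R × A) ℂ) :
    link (M + N) ρ = link M ρ + link N ρ := by
  ext p q
  simp [link, mul_add, Finset.sum_add_distrib]

theorem link_smul_right [Fintype A] (M : Matrix (A × B) (A × B) ℂ) (c : ℂ) (ρ : Matrix (R × A) (R × A) ℂ) :
    link M (c • ρ) = c • link M ρ := by
  ext p q
  simp [link, Finset.mul_sum, mul_assoc]

theorem link_isHermitian [Fintype A] {M : Matrix (A × B) (A × B) ℂ} {ρ : Matrix (R × A) (R × A) ℂ}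
    (hM : M.IsHermitian) (hρ : ρ.IsHermitian) : (link M ρ).IsHermitian := by
  ext p q
  simp only [link, conjTranspose_apply, of_apply, star_sum, star_mul', hM.apply, hρ.apply]
  exact Finset.sum_comm

theorem link_posSemidef [Fintype R] [Fintype A] [Fintype B] {M : Matrix (A × B) (A × B) ℂ} {ρ : Matrix (R × A) (R × A) ℂ}
    (hM : M.PosSemidef) (hρ : ρ.PosSemidef) : (link M ρ).PosSemidef := by
  refine .of_dotProduct_mulVec_nonneg (link_isHermitian hM.1 hρ.1) fun x => ?_
  classical
  -- The quadratic form of `link M ρ` at `x` is that of `ρ ⊗ M` at `x` tensored with the maximally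
  -- entangled vector on the two copies of `A`.
  have h := (hρ.kronecker hM).dotProduct_mulVec_nonneg
    (fun z : (R × A) × (A × B) => if z.1.2 = z.2.1 then x (z.1.1, z.2.2) else 0)
  convert h using 1
  simp only [dotProduct, mulVec, Fintype.sum_prod_type, kroneckerMap_apply, link, of_apply,
    Pi.star_apply, mul_ite, mul_zero, apply_ite star, star_zero, ite_mul, zero_mul]
  simp only [Finset.sum_ite_irrel, Finset.sum_const_zero, Finset.sum_ite_eq, Finset.mem_univ,
    if_true, Finset.mul_sum, Finset.sum_mul]
  refine Finset.sum_congr rfl fun r _ => Eq.trans ?_ Finset.sum_comm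
  refine Finset.sum_congr rfl fun b _ => Eq.trans ?_ Finset.sum_comm
  refine Finset.sum_congr rfl fun s _ => Finset.sum_comm.trans ?_
  exact Finset.sum_congr rfl fun i _ => Finset.sum_comm

theorem trace_mul_partialTraceB [Fintype A] [Fintype B] [DecidableEq B] (S : Matrix A A ℂ)
    (M : Matrix (A × B) (A × B) ℂ) :
    (S * partialTraceB M).trace = ((S ⊗ₖ (1 : Matrix B B ℂ)) * M).trace := by
  simp only [trace, diag_apply, mul_apply, partialTraceB, of_apply, Fintype.sum_prod_type,
    kroneckerMap_apply, one_apply, mul_ite, mul_one, mul_zero, ite_mul, zero_mul,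
    Finset.sum_ite_eq, Finset.mem_univ, if_true, Finset.mul_sum]
  exact Finset.sum_congr rfl fun i _ => Finset.sum_comm

theorem trace_partialTraceB [Fintype A] [Fintype B] (M : Matrix (A × B) (A × B) ℂ) :
    (partialTraceB M).trace = M.trace := by
  simp [trace, partialTraceB, Fintype.sum_prod_type]

theorem partialTraceB_add [Fintype B] (M N : Matrix (A × B) (A × B) ℂ) :
    partialTraceB (M + N) = partialTraceB M + partialTraceB N := by
  ext i j
  simp [partialTraceB, Finset.sum_add_distrib]

theorem partialTraceB_smul [Fintype B] {S : Type*} [DistribSMul S ℂ] (c : S) (M : Matrix (A × B) (A × B) ℂ) :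
    partialTraceB (c • M) = c • partialTraceB M := by
  ext i j
  simp [partialTraceB, Finset.smul_sum]

theorem partialTraceB_kronecker_one [Fintype B] [DecidableEq B] (S : Matrix A A ℂ) :
    partialTraceB (S ⊗ₖ (1 : Matrix B B ℂ)) = (Fintype.card B : ℂ) • S := by
  ext i j
  simp [partialTraceB]

theorem continuous_partialTraceB [Fintype B] :
    Continuous (partialTraceB : Matrix (A × B) (A × B) ℂ → Matrix A A ℂ) := by
  unfold partialTraceB
  fun_prop

theorem continuous_link [Fintype A] (M : Matrix (A × B) (A × B) ℂ) :
    Continuous (link M : Matrix (R × A) (R × A) ℂ → Matrix (R × B) (R × B) ℂ) := by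
  unfold link
  fun_prop

/-- The transpose of the marginal on the second factor. -/
def marginalTranspose [Fintype R] (ρ : Matrix (R × A) (R × A) ℂ) : Matrix A A ℂ :=
  ∑ r, (ρ.submatrix (Prod.mk r) (Prod.mk r))ᵀ

theorem marginalTranspose_posSemidef [Fintype R] {ρ : Matrix (R × A) (R × A) ℂ} (hρ : ρ.PosSemidef) :
    (marginalTranspose ρ).PosSemidef :=
  posSemidef_sum _ fun _ _ => (hρ.submatrix _).transpose

theorem trace_marginalTranspose [Fintype R] [Fintype A] (ρ : Matrix (R × A) (R × A) ℂ) :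
    (marginalTranspose ρ).trace = ρ.trace := by
  simp only [marginalTranspose, trace, diag_apply, Matrix.sum_apply, transpose_apply,
    submatrix_apply, Fintype.sum_prod_type]
  exact Finset.sum_comm

theorem trace_link [Fintype R] [Fintype A] [Fintype B] (M : Matrix (A × B) (A × B) ℂ) (ρ : Matrix (R × A) (R × A) ℂ) :
    (link M ρ).trace = (marginalTranspose ρ * partialTraceB M).trace := by
  simp only [trace, diag_apply, link, of_apply, mul_apply, marginalTranspose, partialTraceB,
    Matrix.sum_apply, transpose_apply, submatrix_apply, Fintype.sum_prod_type, Finset.sum_mul,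
    Finset.mul_sum]
  refine Eq.trans (Finset.sum_congr rfl fun r _ => ?_) Finset.sum_comm
  refine Finset.sum_comm.trans (Eq.trans ?_ Finset.sum_comm)
  exact Finset.sum_congr rfl fun j _ => Finset.sum_comm

/-- The weak duality bound for the trace norm of the output of a difference of positive maps. -/
theorem traceNorm_link_sub_le [Fintype R] [Fintype A] [Fintype B] [DecidableEq R] [DecidableEq A] [DecidableEq B]
    {P Q : Matrix (A × B) (A × B) ℂ} (hP : P.PosSemidef)
    (hQ : Q.PosSemidef) {μ : ℝ}
    (hμ : ((μ : ℂ) • (1 : Matrix A A ℂ) - partialTraceB (P + Q)).PosSemidef)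
    {ρ : Matrix (R × A) (R × A) ℂ} (hρ : IsDensity ρ) : traceNorm (link (P - Q) ρ) ≤ μ := by
  rw [link_sub]
  refine (traceNorm_sub_le (link_posSemidef hP hρ.1) (link_posSemidef hQ hρ.1)).trans ?_
  rw [← link_add, trace_link]
  have h := (marginalTranspose_posSemidef hρ.1).re_trace_mul_nonneg hμ
  rw [mul_sub, trace_sub, mul_smul_comm, mul_one, trace_smul, trace_marginalTranspose, hρ.2] at h
  simpa using h

/-- On pure inputs the action is a congruence, which an invertible `K` can undo. -/
theorem link_vecMulVec [Fintype A] [Fintype B] [DecidableEq B] (M : Matrix (A × B) (A × B) ℂ) (K : Matrix R A ℂ) :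
    link M (vecMulVec (fun p : R × A => K p.1 p.2) (star fun p : R × A => K p.1 p.2)) =
      (K ⊗ₖ (1 : Matrix B B ℂ)) * M * (K ⊗ₖ (1 : Matrix B B ℂ))ᴴ := by
  ext p q
  simp only [link, of_apply, vecMulVec_apply, mul_apply, kroneckerMap_apply, conjTranspose_apply,
    Fintype.sum_prod_type, one_apply, Pi.star_apply, mul_ite, mul_one, mul_zero, ite_mul, zero_mul,
    Finset.sum_ite_eq, Finset.mem_univ, if_true, apply_ite star, star_zero, Finset.sum_mul]
  rw [Finset.sum_comm]
  exact Finset.sum_congr rfl fun i _ => Finset.sum_congr rfl fun j _ => by ring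

theorem choi_isHermitian [DecidableEq A] {Φ : Matrix A A ℂ →ₗ[ℂ] Matrix B B ℂ}
    (hΦ : HermiticityPreserving Φ) : (choi Φ).IsHermitian := by
  -- Apply the hypothesis to the Hermitian matrices `X + Xᴴ` and `i (X - Xᴴ)`.
  have hstar : ∀ X, Φ Xᴴ = (Φ X)ᴴ := fun X => by
    have h1 := hΦ (X + Xᴴ) (isHermitian_add_transpose_self X)
    have h2 := hΦ (Complex.I • (X - Xᴴ)) (by
      rw [IsHermitian, conjTranspose_smul, conjTranspose_sub, conjTranspose_conjTranspose]
      simp only [Complex.star_def, Complex.conj_I, neg_smul, ← smul_neg, neg_sub])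
    rw [IsHermitian, map_add, conjTranspose_add] at h1
    rw [IsHermitian, map_smul, conjTranspose_smul, map_sub, conjTranspose_sub,
      Complex.star_def, Complex.conj_I, neg_smul, ← smul_neg] at h2
    have h3 := smul_right_injective _ Complex.I_ne_zero h2
    linear_combination (norm := module) (2⁻¹ : ℂ) • h3 - (2⁻¹ : ℂ) • h1
  ext p q
  rw [conjTranspose_apply, choi_apply, choi_apply, ← conjTranspose_apply, ← hstar]
  simp

end QMap

/-! ### Strong duality by separation, and attainment of the maximum. -/

namespace QMap

variable {A B : Type*} [Fintype A] [Fintype B]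

/-- A bound on the trace norm of the output for all states bounds the dual objective. -/
theorem re_trace_mul_le_of_posDef [DecidableEq A] [Nonempty A] [DecidableEq B]
    {J : Matrix (A × B) (A × B) ℂ} (hJ : J.IsHermitian) {D : ℝ}
    (hD : ∀ ρ : Matrix (A × A) (A × A) ℂ, IsDensity ρ → traceNorm (link J ρ) ≤ D)
    {Y : Matrix (A × B) (A × B) ℂ} {σ : Matrix A A ℂ} (hσ : σ.PosDef)
    (h₁ : (σ ⊗ₖ (1 : Matrix B B ℂ) - Y).PosSemidef)
    (h₂ : (σ ⊗ₖ (1 : Matrix B B ℂ) + Y).PosSemidef) :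
    (Y * J).trace.re ≤ D * σ.trace.re := by
  have ht : 0 < σ.trace.re := (Complex.lt_def.mp hσ.trace_pos).1
  have htr := hσ.posSemidef.ofReal_re_trace
  obtain ⟨K, rfl⟩ := hσ.posSemidef.exists_eq_conjTranspose_mul_self
  have hK : IsUnit K := by
    have := hσ.isUnit
    rw [isUnit_iff_isUnit_det, det_mul] at this
    exact (isUnit_iff_isUnit_det _).mpr (isUnit_of_mul_isUnit_right this)
  have hdet := (isUnit_iff_isUnit_det _).mp hK
  set t := (Kᴴ * K).trace.re
  set L : Matrix (A × B) (A × B) ℂ := K ⊗ₖ (1 : Matrix B B ℂ) with hL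
  set L' : Matrix (A × B) (A × B) ℂ := K⁻¹ ⊗ₖ (1 : Matrix B B ℂ) with hL'
  have hLL' : L * L' = 1 := by
    rw [hL, hL', ← mul_kronecker_mul, mul_nonsing_inv _ hdet, mul_one, one_kronecker_one]
  have hL'L : L' * L = 1 := by
    rw [hL, hL', ← mul_kronecker_mul, nonsing_inv_mul _ hdet, mul_one, one_kronecker_one]
  have hLH : (Kᴴ * K) ⊗ₖ (1 : Matrix B B ℂ) = Lᴴ * L := by
    rw [hL, conjTranspose_kronecker, ← mul_kronecker_mul, conjTranspose_one, mul_one]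
  have hone : L'ᴴ * (Lᴴ * L) * L' = 1 := by
    rw [← mul_assoc, ← conjTranspose_mul, hLL', conjTranspose_one, one_mul, hLL']
  rw [hLH] at h₁ h₂
  set ψ : A × A → ℂ := fun p => K p.1 p.2
  set ρ : Matrix (A × A) (A × A) ℂ := ((t⁻¹ : ℝ) : ℂ) • vecMulVec ψ (star ψ)
  have hρ : IsDensity ρ := by
    refine ⟨(posSemidef_vecMulVec_self_star ψ).smul (by exact_mod_cast (inv_pos.mpr ht).le), ?_⟩
    have : (vecMulVec ψ (star ψ)).trace = t := by
      rw [htr]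
      simp only [trace, diag_apply, vecMulVec_apply, Fintype.sum_prod_type, mul_apply,
        conjTranspose_apply, Pi.star_apply, ψ]
      rw [Finset.sum_comm]
      simp only [mul_comm]
    rw [trace_smul, this, smul_eq_mul, ← Complex.ofReal_mul, inv_mul_cancel₀ ht.ne',
      Complex.ofReal_one]
  -- Conjugation by `L'` turns `σ ⊗ 1` into `1`, so the rescaled `Y` is an admissible `W`.
  have hb : (L'ᴴ * Y * L' * link J ρ).trace.re ≤ traceNorm (link J ρ) := by
    refine re_trace_mul_le_traceNorm (link_isHermitian hJ hρ.1.1) ?_ ?_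
    · have := h₁.conjTranspose_mul_mul_same L'
      rwa [mul_sub, sub_mul, hone] at this
    · have := h₂.conjTranspose_mul_mul_same L'
      rwa [mul_add, add_mul, hone] at this
  have he : (L'ᴴ * Y * L' * link J ρ).trace = ((t⁻¹ : ℝ) : ℂ) * (Y * J).trace := by
    rw [link_smul_right, link_vecMulVec, ← hL, mul_smul_comm, trace_smul, smul_eq_mul]
    congr 1
    have : L'ᴴ * Y * L' * (L * J * Lᴴ) = L'ᴴ * (Y * J * Lᴴ) := by
      calc _ = L'ᴴ * (Y * (L' * L) * J * Lᴴ) := by simp only [mul_assoc]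
        _ = _ := by rw [hL'L, mul_one]
    rw [this, trace_mul_comm, mul_assoc, ← conjTranspose_mul, hL'L, conjTranspose_one, mul_one]
  rw [he, Complex.re_ofReal_mul] at hb
  have := hb.trans (hD ρ hρ)
  rwa [inv_mul_le_iff₀ ht, mul_comm] at this

/-- Perturb `σ` to the invertible `σ + ε • 1` and let `ε → 0`. -/
theorem re_trace_mul_le_of_posSemidef [DecidableEq A] [Nonempty A] [DecidableEq B]
    {J : Matrix (A × B) (A × B) ℂ} (hJ : J.IsHermitian) {D : ℝ}
    (hD : ∀ ρ : Matrix (A × A) (A × A) ℂ, IsDensity ρ → traceNorm (link J ρ) ≤ D)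
    {Y : Matrix (A × B) (A × B) ℂ} {σ : Matrix A A ℂ} (hσ : σ.PosSemidef)
    (h₁ : (σ ⊗ₖ (1 : Matrix B B ℂ) - Y).PosSemidef)
    (h₂ : (σ ⊗ₖ (1 : Matrix B B ℂ) + Y).PosSemidef) :
    (Y * J).trace.re ≤ D * σ.trace.re := by
  have key : ∀ ε : ℝ, 0 < ε → (Y * J).trace.re ≤ D * (σ.trace.re + ε * Fintype.card A) := by
    intro ε hε
    have hε' : (0 : ℂ) < (ε : ℂ) := by exact_mod_cast hε
    have hp : (((ε : ℂ) • (1 : Matrix A A ℂ)) ⊗ₖ (1 : Matrix B B ℂ)).PosSemidef :=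
      (PosSemidef.one.smul hε'.le).kronecker PosSemidef.one
    have h := re_trace_mul_le_of_posDef hJ hD (Y := Y) (σ := σ + (ε : ℂ) • 1)
      (PosDef.posSemidef_add hσ (PosDef.one.smul hε')) ?_ ?_
    · simpa [trace_add, trace_smul] using h
    · rw [add_kronecker, add_sub_right_comm]
      exact h₁.add hp
    · rw [add_kronecker, add_right_comm]
      exact h₂.add hp
  have hlim : Filter.Tendsto (fun ε : ℝ => D * (σ.trace.re + ε * Fintype.card A))
      (nhdsWithin 0 (Set.Ioi 0)) (nhds (D * (σ.trace.re + 0 * Fintype.card A))) :=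
    (Continuous.tendsto (by fun_prop) 0).mono_left nhdsWithin_le_nhds
  have := ge_of_tendsto hlim (Filter.eventually_of_mem self_mem_nhdsWithin key)
  simpa using this

/-- The pairs `(M₊ - M₋, Tr_B (M₊ + M₋) + S)` with `M₊`, `M₋` and `S` positive semidefinite. -/
def decompositionCone (A B : Type*) [Fintype A] [Fintype B] :
    Set (Matrix (A × B) (A × B) ℂ × Matrix A A ℂ) :=
  {x | ∃ P Q : Matrix (A × B) (A × B) ℂ, ∃ S : Matrix A A ℂ,
    P.PosSemidef ∧ Q.PosSemidef ∧ S.PosSemidef ∧ x = (P - Q, partialTraceB (P + Q) + S)}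

theorem convex_decompositionCone : Convex ℝ (decompositionCone A B) := by
  rintro _ ⟨P, Q, S, hP, hQ, hS, rfl⟩ _ ⟨P', Q', S', hP', hQ', hS', rfl⟩ a b ha hb -
  refine ⟨a • P + b • P', a • Q + b • Q', a • S + b • S', (hP.smul ha).add (hP'.smul hb),
    (hQ.smul ha).add (hQ'.smul hb), (hS.smul ha).add (hS'.smul hb), ?_⟩
  simp only [partialTraceB_add, partialTraceB_smul, Prod.smul_mk, Prod.mk_add_mk, Prod.mk.injEq]
  constructor <;> module

theorem smul_mem_decompositionCone {x : Matrix (A × B) (A × B) ℂ × Matrix A A ℂ}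
    (hx : x ∈ decompositionCone A B) {c : ℝ} (hc : 0 ≤ c) : c • x ∈ decompositionCone A B := by
  obtain ⟨P, Q, S, hP, hQ, hS, rfl⟩ := hx
  refine ⟨c • P, c • Q, c • S, hP.smul hc, hQ.smul hc, hS.smul hc, ?_⟩
  simp only [partialTraceB_add, partialTraceB_smul, Prod.smul_mk, Prod.mk.injEq]
  constructor <;> module

/-- The trace of the second component is `Tr P + Tr Q + Tr S`. Near a given point it bounds all
three, so the cone lies locally in a compact image contained in the cone. -/
theorem isClosed_decompositionCone : IsClosed (decompositionCone A B) := by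
  refine isClosed_of_closure_subset fun x hx => ?_
  set R := x.2.trace.re + 1
  let F : Matrix (A × B) (A × B) ℂ × Matrix (A × B) (A × B) ℂ × Matrix A A ℂ →
      Matrix (A × B) (A × B) ℂ × Matrix A A ℂ :=
    fun y => (y.1 - y.2.1, partialTraceB (y.1 + y.2.1) + y.2.2)
  have hF : Continuous F := by
    have := continuous_partialTraceB (A := A) (B := B)
    fun_prop
  have hT := (((isCompact_posSemidef_trace_le (n := A × B) R).prod
    ((isCompact_posSemidef_trace_le (n := A × B) R).prod
      (isCompact_posSemidef_trace_le (n := A) R))).image hF).isClosed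
  have hU : IsOpen {y : Matrix (A × B) (A × B) ℂ × Matrix A A ℂ | y.2.trace.re < R} :=
    isOpen_lt (Complex.continuous_re.comp continuous_snd.matrix_trace) continuous_const
  have hx' := hU.inter_closure ⟨show x.2.trace.re < R by simp [R], hx⟩
  have hsub : {y : Matrix (A × B) (A × B) ℂ × Matrix A A ℂ | y.2.trace.re < R} ∩
      decompositionCone A B ⊆ F '' ({P | P.PosSemidef ∧ P.trace.re ≤ R} ×ˢ
        ({P | P.PosSemidef ∧ P.trace.re ≤ R} ×ˢ {P | P.PosSemidef ∧ P.trace.re ≤ R})) := by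
    rintro _ ⟨hy, P, Q, S, hP, hQ, hS, rfl⟩
    simp only [Set.mem_ofPred_eq, trace_add, trace_partialTraceB, Complex.add_re] at hy
    have := hP.re_trace_nonneg
    have := hQ.re_trace_nonneg
    have := hS.re_trace_nonneg
    exact ⟨(P, Q, S), ⟨⟨hP, by linarith⟩, ⟨hQ, by linarith⟩, ⟨hS, by linarith⟩⟩, rfl⟩
  obtain ⟨⟨P, Q, S⟩, ⟨hP, hQ, hS⟩, rfl⟩ := closure_minimal hsub hT hx'
  exact ⟨P, Q, S, hP.1, hQ.1, hS.1, rfl⟩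

theorem exists_trace_mul_eq {n : Type*} [Fintype n] [DecidableEq n]
    (f : Matrix n n ℂ →ₗ[ℂ] ℂ) : ∃ Z : Matrix n n ℂ, ∀ X, f X = (Z * X).trace := by
  refine ⟨of fun i j => f (single j i 1), fun X => ?_⟩
  conv_lhs => rw [matrix_eq_sum_single X]
  simp only [map_sum, trace, diag_apply, mul_apply, of_apply]
  rw [Finset.sum_comm]
  refine Finset.sum_congr rfl fun i _ => Finset.sum_congr rfl fun j _ => ?_
  rw [← mul_one (X _ _), ← smul_eq_mul, ← smul_single, map_smul]
  simp [mul_comm]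

theorem mem_decompositionCone [DecidableEq A] [Nonempty A] [DecidableEq B]
    {J : Matrix (A × B) (A × B) ℂ} (hJ : J.IsHermitian) {D : ℝ}
    (hD : ∀ ρ : Matrix (A × A) (A × A) ℂ, IsDensity ρ → traceNorm (link J ρ) ≤ D) :
    (J, (D : ℂ) • (1 : Matrix A A ℂ)) ∈ decompositionCone A B := by
  by_contra hmem
  have : LocallyConvexSpace ℝ (Matrix (A × B) (A × B) ℂ) :=
    inferInstanceAs (LocallyConvexSpace ℝ (A × B → A × B → ℂ))
  have : LocallyConvexSpace ℝ (Matrix A A ℂ) :=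
    inferInstanceAs (LocallyConvexSpace ℝ (A → A → ℂ))
  obtain ⟨f, u, hfu, hf⟩ := RCLike.geometric_hahn_banach_closed_point (𝕜 := ℂ)
    convex_decompositionCone isClosed_decompositionCone hmem
  have h0 : 0 < u := by
    have := hfu 0 ⟨0, 0, 0, .zero, .zero, .zero, by ext <;> simp [partialTraceB]⟩
    simpa using this
  -- Otherwise scaling `x` by `u / (f x).re` reaches the value `u` inside the cone.
  have hle : ∀ x ∈ decompositionCone A B, (f x).re ≤ 0 := by
    intro x hx
    by_contra! hpos
    have := hfu _ (smul_mem_decompositionCone hx (div_pos h0 hpos).le)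
    rw [← Complex.coe_smul, map_smul] at this
    simp [hpos.ne'] at this
  obtain ⟨Z, hZ⟩ := exists_trace_mul_eq (f.toLinearMap ∘ₗ LinearMap.inl ℂ _ _)
  obtain ⟨T, hT⟩ := exists_trace_mul_eq (f.toLinearMap ∘ₗ LinearMap.inr ℂ _ _)
  have hfx : ∀ X S, (f (X, S)).re = (Z * X).trace.re + (T * S).trace.re := by
    intro X S
    rw [← Complex.add_re, ← hZ, ← hT]
    simp [← map_add]
  have hpt : ∀ M : Matrix (A × B) (A × B) ℂ, M.PosSemidef → (partialTraceB M).IsHermitian := by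
    intro M hM
    ext i j
    simp [partialTraceB, ← hM.1.apply (i, _) (j, _)]
  -- Only real parts at Hermitian arguments matter, so Hermitian parts represent `f`; the sign makes
  -- `σ ≥ 0`.
  set Y := hermitianPart Z
  set σ := -hermitianPart T
  have hY : Y.IsHermitian := isHermitian_hermitianPart Z
  have hσ : σ.IsHermitian := (isHermitian_hermitianPart T).neg
  have hfh : ∀ X S, X.IsHermitian → S.IsHermitian →
      (f (X, S)).re = (Y * X).trace.re - (σ * S).trace.re := by
    intro X S hX hS
    rw [hfx, ← hX.re_trace_hermitianPart_mul, ← hS.re_trace_hermitianPart_mul]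
    simp [σ, Y]
  have hσI : (σ ⊗ₖ (1 : Matrix B B ℂ)).IsHermitian := by
    rw [IsHermitian, conjTranspose_kronecker, hσ.eq, conjTranspose_one]
  have hσp : σ.PosSemidef := hσ.posSemidef_of_re_trace_mul fun S hS => by
    have := hle (0, S) ⟨0, 0, S, .zero, .zero, hS, by ext <;> simp [partialTraceB]⟩
    rw [hfh _ _ isHermitian_zero hS.1] at this
    simpa using this
  -- The generators `(± M, Tr_B M)` of the cone give the two bounds on `Y`.
  have h₁ : (σ ⊗ₖ (1 : Matrix B B ℂ) - Y).PosSemidef :=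
    (hσI.sub hY).posSemidef_of_re_trace_mul fun M hM => by
      have := hle (M, partialTraceB M) ⟨M, 0, 0, hM, .zero, .zero, by simp⟩
      rw [hfh _ _ hM.1 (hpt M hM), trace_mul_partialTraceB] at this
      rw [sub_mul, trace_sub, Complex.sub_re]
      linarith
  have h₂ : (σ ⊗ₖ (1 : Matrix B B ℂ) + Y).PosSemidef :=
    (hσI.add hY).posSemidef_of_re_trace_mul fun M hM => by
      have := hle (-M, partialTraceB M) ⟨0, M, 0, .zero, hM, .zero, by simp⟩
      rw [hfh _ _ hM.1.neg (hpt M hM), trace_mul_partialTraceB] at this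
      rw [add_mul, trace_add, Complex.add_re]
      simp only [mul_neg, trace_neg, Complex.neg_re] at this
      linarith
  have hD1 : ((D : ℂ) • (1 : Matrix A A ℂ)).IsHermitian := by
    simp [IsHermitian, conjTranspose_smul]
  have hfin := h0.trans hf
  change 0 < (f _).re at hfin
  rw [hfh _ _ hJ hD1, mul_smul_comm, mul_one, trace_smul, smul_eq_mul,
    Complex.re_ofReal_mul] at hfin
  linarith [re_trace_mul_le_of_posSemidef hJ hD hσp h₁ h₂]

theorem exists_isDensity [DecidableEq A] [Nonempty A] :
    ∃ ρ : Matrix A A ℂ, IsDensity ρ := by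
  obtain ⟨a⟩ := ‹Nonempty A›
  refine ⟨vecMulVec (Pi.single a 1) (star (Pi.single a 1)), posSemidef_vecMulVec_self_star _, ?_⟩
  simp [trace_vecMulVec]

/-- The maximum in the definition of the diamond norm is attained. -/
theorem exists_isGreatest_diamondValues [DecidableEq A] [Nonempty A] [DecidableEq B]
    {Φ : Matrix A A ℂ →ₗ[ℂ] Matrix B B ℂ} (hΦ : HermiticityPreserving Φ) :
    ∃ D, IsGreatest (diamondValues Φ) D := by
  have hH : ∀ ρ : Matrix (A × A) (A × A) ℂ, IsDensity ρ → (idTensor A Φ ρ).IsHermitian := by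
    intro ρ hρ
    rw [idTensor_eq_link]
    exact link_isHermitian (choi_isHermitian hΦ) hρ.1.1
  have hS : IsCompact {ρ : Matrix (A × A) (A × A) ℂ | IsDensity ρ} := by
    refine (isCompact_posSemidef_trace_le 1).of_isClosed_subset ?_ fun ρ hρ => ⟨hρ.1, ?_⟩
    · exact isClosed_setOf_posSemidef.inter
        (isClosed_eq continuous_id.matrix_trace continuous_const)
    · simp [hρ.2]
  -- Maximising jointly over `ρ` and `W` avoids proving the trace norm continuous. With `P = 1 + W`
  -- the constraint is `0 ≤ P ≤ 2`, so `N` bounds the trace of `P`.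
  set N : ℝ := 2 * Fintype.card (A × B)
  have hg : Continuous fun y : Matrix (A × A) (A × A) ℂ × Matrix (A × B) (A × B) ℂ =>
      ((y.2 - 1) * idTensor A Φ y.1).trace.re := by
    simp only [idTensor_eq_link]
    have := continuous_link (R := A) (choi Φ)
    exact Complex.continuous_re.comp (Continuous.matrix_trace (by fun_prop))
  have hK : IsCompact {P : Matrix (A × B) (A × B) ℂ |
      (P.PosSemidef ∧ P.trace.re ≤ N) ∧ (2 - P).PosSemidef} :=
    (isCompact_posSemidef_trace_le N).inter_right
      (isClosed_setOf_posSemidef.preimage (continuous_const.sub continuous_id))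
  obtain ⟨ρ₀, hρ₀⟩ := exists_isDensity (A := A × A)
  have hmemK : ∀ W : Matrix (A × B) (A × B) ℂ, (1 - W).PosSemidef → (1 + W).PosSemidef →
      1 + W ∈ {P : Matrix (A × B) (A × B) ℂ |
        (P.PosSemidef ∧ P.trace.re ≤ N) ∧ (2 - P).PosSemidef} := by
    intro W h₁ h₂
    refine ⟨⟨h₂, ?_⟩, ?_⟩
    · have := h₁.re_trace_nonneg
      simp only [trace_sub, trace_add, trace_one, Complex.sub_re, Complex.add_re,
        Complex.natCast_re, N] at this ⊢
      linarith
    · convert h₁ using 1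
      rw [← one_add_one_eq_two]
      abel
  obtain ⟨⟨ρ, P⟩, ⟨hρ, hP⟩, hmax⟩ := (hS.prod hK).exists_isMaxOn
    ⟨(ρ₀, 1 + 0), hρ₀, hmemK 0 (by simpa using PosSemidef.one) (by simpa using PosSemidef.one)⟩
    hg.continuousOn
  refine ⟨traceNorm (idTensor A Φ ρ), ⟨ρ, hρ, rfl⟩, ?_⟩
  rintro _ ⟨τ, hτ, rfl⟩
  obtain ⟨W, h₁, h₂, h⟩ := exists_re_trace_mul_eq_traceNorm (hH τ hτ)
  have hm := hmax (Set.mk_mem_prod hτ (hmemK W h₁ h₂))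
  simp only [Set.mem_ofPred_eq, add_sub_cancel_left, h] at hm
  refine hm.trans (re_trace_mul_le_traceNorm (hH ρ hρ) ?_ ?_)
  · convert hP.2 using 1
    rw [← one_add_one_eq_two]
    abel
  · simpa using hP.1.1

end QMap

/-! ### The duality theorem. -/

theorem lemma1 {A B : Type*} [Fintype A] [DecidableEq A] [Nonempty A]
    [Fintype B] [DecidableEq B]
    (Φ : Matrix A A ℂ →ₗ[ℂ] Matrix B B ℂ) (hΦ : QMap.HermiticityPreserving Φ) :
    IsGreatest (QMap.diamondValues Φ) (QMap.diamondNorm Φ) ∧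
    IsLeast {μ : ℝ | ∃ Mp Mm : Matrix (A × B) (A × B) ℂ,
        QMap.choi Φ = Mp - Mm ∧ Mp.PosSemidef ∧ Mm.PosSemidef ∧
        ((μ : ℂ) • (1 : Matrix A A ℂ) - QMap.partialTraceB (Mp + Mm)).PosSemidef}
      (QMap.diamondNorm Φ) ∧
    IsLeast {μ : ℝ | ∃ Mp Mm : Matrix (A × B) (A × B) ℂ,
        QMap.choi Φ = Mp - Mm ∧ Mp.PosSemidef ∧ Mm.PosSemidef ∧
        QMap.partialTraceB (Mp + Mm) = (μ : ℂ) • (1 : Matrix A A ℂ)}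
      (QMap.diamondNorm Φ) := by
  obtain ⟨D, hD⟩ := QMap.exists_isGreatest_diamondValues hΦ
  rw [show QMap.diamondNorm Φ = D from hD.csSup_eq]
  obtain ⟨ρ, hρ, hDρ⟩ := hD.1
  have hlow : ∀ μ : ℝ, (∃ Mp Mm : Matrix (A × B) (A × B) ℂ,
      QMap.choi Φ = Mp - Mm ∧ Mp.PosSemidef ∧ Mm.PosSemidef ∧
      ((μ : ℂ) • (1 : Matrix A A ℂ) - QMap.partialTraceB (Mp + Mm)).PosSemidef) → D ≤ μ := by
    rintro μ ⟨P, Q, hJ, hP, hQ, hμ⟩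
    rw [hDρ, QMap.idTensor_eq_link, hJ]
    exact QMap.traceNorm_link_sub_le hP hQ hμ hρ
  obtain ⟨P, Q, S, hP, hQ, hS, hx⟩ := QMap.mem_decompositionCone (D := D)
    (QMap.choi_isHermitian hΦ) fun τ hτ => by
      rw [← QMap.idTensor_eq_link]
      exact hD.2 ⟨τ, hτ, rfl⟩
  obtain ⟨hJ, hDS⟩ := Prod.mk.inj hx
  refine ⟨hD, ⟨⟨P, Q, hJ, hP, hQ, by rwa [hDS, add_sub_cancel_left]⟩, hlow⟩, ?_, ?_⟩
  -- For empty `B` the slack cannot be absorbed, but then `D = 0` and both sides vanish.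
  · cases isEmpty_or_nonempty B with
    | inl h =>
      refine ⟨P, Q, hJ, hP, hQ, ?_⟩
      have hD0 : D = 0 := by rw [hDρ]; simp [QMap.traceNorm]
      ext i j
      simp [QMap.partialTraceB, hD0]
    | inr h =>
      have hcard : (Fintype.card B : ℂ) ≠ 0 := by simp
      have hc : (0 : ℂ) ≤ ((2 * Fintype.card B : ℝ)⁻¹ : ℝ) := by
        exact_mod_cast (by positivity : (0 : ℝ) ≤ (2 * Fintype.card B : ℝ)⁻¹)
      -- Adding the same `S ⊗ 1 / (2 dim B)` to `P` and `Q` keeps their difference and adds exactly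
      -- `S` to the partial trace of the sum.
      have hE := (hS.kronecker (PosSemidef.one (n := B) (R := ℂ))).smul hc
      refine ⟨_, _, ?_, hP.add hE, hQ.add hE, ?_⟩
      · rw [hJ, add_sub_add_right_eq_sub]
      · rw [hDS]
        simp only [QMap.partialTraceB_add, QMap.partialTraceB_smul,
          QMap.partialTraceB_kronecker_one, smul_smul]
        have h2 : (((2 * Fintype.card B : ℝ)⁻¹ : ℝ) : ℂ) * (Fintype.card B : ℂ) = 2⁻¹ := by
          push_cast
          field_simp
        rw [h2]
        module
  · rintro μ ⟨P, Q, hJ, hP, hQ, hμ⟩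
    exact hlow μ ⟨P, Q, hJ, hP, hQ, by rw [hμ, sub_self]; exact .zero⟩
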